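/- Let $d\ge 1$ and $N\ge 0$ be integers, let $X,Y$ be random vectors in $\mathbb R^d$ with distribution functions $F_X,F_Y$ and one-dimensional marginals $F_{X_i},F_{Y_i}$, and let $C_X, C_Y$ be copulas of $F_X,F_Y$, i.e. probability distributions on $[0,1]^d$ with uniform one-dimensional marginals such that $F_X(x)=C_X(F_{X_1}(x_1),\dots,F_{X_d}(x_d))$ for all $x$, and likewise for $Y$. Let $R=C_X\otimes C_Y$, a distribution on $[0,1]^{2d}$ whose points are written $\mathbf u=(\mathbf u_x,\mathbf u_y)=(u_1,\dots,u_{2d})$. Let $\bar F_X^{-1}(\mathbf u_x)$ be the vector with components $\sup\{x:F_{X_i}(x)\le u_i\}$, define $\bar F_Y^{-1}(\mathbf u_y)$ in the same way, let $\Delta:\mathbb R^d\times\mathbb R^d\to[0,\infty)$ be measurable, and put $\delta(\mathbf u)=\Delta(\bar F_X^{-1}(\mathbf u_x),\bar F_Y^{-1}(\mathbf u_y))$. Let $\alpha_n=\frac1{n+1}$ be the $n$-th moment of the uniform distribution on $[0,1]$ and $I=\{1,\dots,2d\}\times\{1,\dots,N\}$. For $D\ge 0$, Problem 2 is $$\min\{\mathrm{KL}(Q\|R)\;:\;Q\text{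 a probability distribution on }[0,1]^{2d},\ \mathbb E_Q[\delta]=D,\ \mathbb E_Q[u_i^n]=\alpha_n\ \text{for all }(i,n)\in I\}.$$ Let $D_{\min}=\inf\mathbb E_Q[\delta]$ over the probability distributions $Q$ with $\mathrm{KL}(Q\|R)<\infty$ and $\mathbb E_Q[u_i^n]=\alpha_n$ for all $(i,n)\in I$, and let $D_{\max}=\mathbb E_R[\delta]\in[0,\infty]$. Assume that $D_{\min}\le D\le D_{\max}$, with $D\neq D_{\min}$ unless $D_{\min}=D_{\max}$. Suppose that some probability distribution $P$ on $[0,1]^{2d}$ satisfies $\mathrm{KL}(P\|R)<\infty$ and $\mathbb E_P[\delta]=D$. Then Problem 2 has a minimizer $Q$ that is absolutely continuous with respect to $R$ with $$\frac{dQ}{dR}(\mathbf u)=e^{\mu+\theta\,\delta(\mathbf u)}\prod_{i=1}^{2d}e^{\sum_{n=1}^N\nu_{i,n}u_i^n}\qquad R\text{-a.e.},$$ where $(\mu,\theta,(\nu_{i,n})_{(i,n)\in I})$ are real numbers that solve the dual program $$\min_{(\mu,\theta,(\nu_{i,n}))}\; -\mu-\theta D-\sum_{(i,n)\in I}\nu_{i,n}\alpha_n+\Big(\int_{[0,1]^{2d}}e^{\mu+\theta\,\delta(\mathbf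 u)+\sum_{(i,n)\in I}\nu_{i,n}u_i^n}\,dR(\mathbf u)-1\Big)$$ over all real multipliers (the objective is $+\infty$ where the integral diverges). The dual program has a solution, and every solution of it gives this density. -/

import Mathlib

open MeasureTheory ProbabilityTheory
open scoped NNReal ENNReal unitInterval

noncomputable section

/-- A copula on the cube `[0,1]^d`: a probability measure all of whose one-dimensional marginals
are uniform on `[0,1]`. -/
structure IsCopula {d : ℕ} (C : Measure (Fin d → I)) : Prop where
  isProb : IsProbabilityMeasure C
  uniform_marginal : ∀ i, C.map (fun u => u i) = (volume : Measure I)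

/-- The `i`-th marginal of a law on `ℝ^d`. -/
def marginalLaw {d : ℕ} (m : Measure (Fin d → ℝ)) (i : Fin d) : Measure ℝ :=
  m.map (fun x => x i)

/-- `C` is a copula of the law `m` on `ℝ^d` (Sklar's relation):
`F(x_1, …, x_d) = C(F_1(x_1), …, F_d(x_d))` for the distribution functions. -/
structure IsCopulaOf {d : ℕ} (C : Measure (Fin d → I)) (m : Measure (Fin d → ℝ)) : Prop where
  isCopula : IsCopula C
  sklar : ∀ x : Fin d → ℝ,
    m (Set.Iic x) = C {u | ∀ i, (u i : ℝ) ≤ cdf (marginalLaw m i) (x i)}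

/-- The quantile function `u ↦ sup {x : F(x) ≤ u}` of a law on `ℝ`. For `0 < u < 1` the set is
nonempty and bounded above; the two end points are negligible for the uniform law. -/
def quantile (m : Measure ℝ) (u : ℝ) : ℝ := sSup {x : ℝ | cdf m x ≤ u}

/-- The coordinatewise quantile function `[0,1]^d → ℝ^d` of a law on `ℝ^d`. -/
def vecQuantile {d : ℕ} (m : Measure (Fin d → ℝ)) (u : Fin d → I) : Fin d → ℝ :=
  fun i => quantile (marginalLaw m i) (u i)

/-- The cube `[0,1]^{2d}`, with points `u = (u_x, u_y)`. -/
abbrev Cube (d : ℕ) : Type := (Fin d → I) × (Fin d → I)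

/-- The `2d` coordinates of a point of `[0,1]^{2d}`, as real numbers. -/
def coord {d : ℕ} (i : Fin d ⊕ Fin d) (u : Cube d) : ℝ :=
  Sum.elim (fun j => (u.1 j : ℝ)) (fun j => (u.2 j : ℝ)) i

/-- The `n`-th moment of the uniform distribution on `[0,1]`. -/
def uniformMoment (n : ℕ) : ℝ := ∫ x : I, (x : ℝ) ^ n

/-- The distortion in copula coordinates, `Δ(F_X⁻¹(u_x), F_Y⁻¹(u_y))`. -/
def copulaDistortion {d : ℕ} (mX mY : Measure (Fin d → ℝ))
    (Δ : (Fin d → ℝ) → (Fin d → ℝ) → ℝ≥0) (u : Cube d) : ℝ≥0 :=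
  Δ (vecQuantile mX u.1) (vecQuantile mY u.2)

/-- The expectation of a nonnegative function `δ` under `Q`, in `[0,∞]`. -/
def expDistortion {d : ℕ} (δ : Cube d → ℝ≥0) (Q : Measure (Cube d)) : ℝ≥0∞ :=
  ∫⁻ u, (δ u : ℝ≥0∞) ∂Q

/-- All coordinates have the same moments of orders `1, …, N` as the uniform distribution.
(The index `n : Fin N` stands for the order `n + 1`.) -/
def MomentConstraints {d : ℕ} (N : ℕ) (Q : Measure (Cube d)) : Prop :=
  ∀ (i : Fin d ⊕ Fin d) (n : Fin N),
    ∫ u, coord i u ^ ((n : ℕ) + 1) ∂Q = uniformMoment ((n : ℕ) + 1)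

/-- The constraint set of the moment-relaxed problem at distortion level `D`. -/
def Feasible {d : ℕ} (N : ℕ) (δ : Cube d → ℝ≥0) (D : ℝ≥0) (Q : Measure (Cube d)) : Prop :=
  IsProbabilityMeasure Q ∧ expDistortion δ Q = D ∧ MomentConstraints N Q

/-- `Q` minimizes `KL(· ‖ R)` over the constraint set of the moment-relaxed problem. -/
def IsMinimizer {d : ℕ} (N : ℕ) (δ : Cube d → ℝ≥0) (D : ℝ≥0) (R Q : Measure (Cube d)) : Prop :=
  Feasible N δ D Q ∧
    ∀ Q', Feasible N δ D Q' → InformationTheory.klDiv Q R ≤ InformationTheory.klDiv Q' R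

/-- `D_min`: the infimum of the distortions of the probability measures that satisfy the moment
constraints and have finite divergence from `R`. -/
def distortionMin {d : ℕ} (N : ℕ) (δ : Cube d → ℝ≥0) (R : Measure (Cube d)) : ℝ≥0∞ :=
  sInf {e | ∃ Q : Measure (Cube d), IsProbabilityMeasure Q ∧ MomentConstraints N Q ∧
    InformationTheory.klDiv Q R < ∞ ∧ e = expDistortion δ Q}

/-- `D_max`: the distortion of the independent coupling `R` (the zero-rate distortion). -/
def distortionMax {d : ℕ} (δ : Cube d → ℝ≥0) (R : Measure (Cube d)) : ℝ≥0∞ :=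
  expDistortion δ R

/-- The multipliers `(μ, θ, (ν_{i,n}))`; `nu i n` belongs to the moment of order `n + 1`. -/
structure Multipliers (d N : ℕ) where
  mu : ℝ
  theta : ℝ
  nu : Fin d ⊕ Fin d → Fin N → ℝ

/-- `exp(μ + θ δ(u)) ∏_i exp(∑_n ν_{i,n} u_i^n)`. -/
def expDensity {d N : ℕ} (δ : Cube d → ℝ≥0) (l : Multipliers d N) (u : Cube d) : ℝ :=
  Real.exp (l.mu + l.theta * (δ u : ℝ)) *
    ∏ i, Real.exp (∑ n : Fin N, l.nu i n * coord i u ^ ((n : ℕ) + 1))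

/-- The total mass of the exponential density under `R`, in `[0,∞]`. -/
def expMass {d N : ℕ} (δ : Cube d → ℝ≥0) (R : Measure (Cube d)) (l : Multipliers d N) : ℝ≥0∞ :=
  ∫⁻ u, ENNReal.ofReal (expDensity δ l u) ∂ R

/-- The objective of the dual program,
`-μ - θ D - ∑_{i,n} ν_{i,n} α_n + (∫ exp(μ + θ δ + ∑ ν_{i,n} u_i^n) dR - 1)`,
with values in `(-∞, +∞]`: it is `+∞` where the integral diverges. -/
def dualObjective {d N : ℕ} (δ : Cube d → ℝ≥0) (D : ℝ≥0) (R : Measure (Cube d))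
    (l : Multipliers d N) : EReal :=
  ((-l.mu - l.theta * (D : ℝ)
      - ∑ i, ∑ n : Fin N, l.nu i n * uniformMoment ((n : ℕ) + 1) : ℝ) : EReal)
    + ((expMass δ R l : EReal) - 1)

/-- The multipliers solve the dual program. -/
def IsDualSolution {d N : ℕ} (δ : Cube d → ℝ≥0) (D : ℝ≥0) (R : Measure (Cube d))
    (l : Multipliers d N) : Prop :=
  ∀ l' : Multipliers d N, dualObjective δ D R l ≤ dualObjective δ D R l'

/-- `Q` is absolutely continuous with respect to `R` with the exponential density given by the
multipliers. -/
def HasExpDensity {d N : ℕ} (δ : Cube d → ℝ≥0) (R Q : Measure (Cube d))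
    (l : Multipliers d N) : Prop :=
  Q ≪ R ∧ Q.rnDeriv R =ᵐ[R] fun u => ENNReal.ofReal (expDensity δ l u)

end

/-! The proof is convex duality for entropy, with the dual minimum attained by a coercivity
argument. Let `F v` be the bounded function `μ + ∑ ν_{i,n} u_i^n` with `v = (μ, ν)`. Since `R`
itself satisfies the moment constraints, the dual objective is, up to a constant, `H(θ, v) = ∫ exp
(θ δ + F v) dR - θ D - ∫ F v dR`.

If `D = D_max`, then `R` is feasible and all multipliers vanish. Otherwise `D_min < D < D_max`,
where `D_max` may be infinite. On `θ ≤ 0` the integral is always finite, and there `H` attains its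
minimum. A measure of finite divergence with distortion below `D` makes `H` large as `θ → -∞`, by
Donsker–Varadhan; for bounded `θ`, `H` is coercive in `v` modulo the `v` with `F v = 0` a.e.
(`IsBoundedFamily.exists_coercive`). The condition `D < D_max` forces `θ < 0` at the minimum, so `θ`
may vary in both directions, and the first-order conditions say exactly that `exp (θ δ + F v) dR` is
feasible; the `μ`-direction gives total mass one.

A feasible exponential measure is optimal on both sides
(`isMinimizer_and_isDualSolution_of_feasible`): its exponent has the same mean under all feasible
measures, so Donsker–Varadhan gives primal optimality; the tangent inequality for `exp` gives dual
optimality, and its strictness makes the density unique among dual solutions. -/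

theorem mul_sub_log_add_one_le_exp {q : ℝ} (hq : 0 ≤ q) (x : ℝ) :
    q * (x - Real.log q + 1) ≤ Real.exp x := by
  rcases hq.eq_or_lt with rfl | hq
  · simpa using (Real.exp_pos x).le
  · have h := mul_le_mul_of_nonneg_left (Real.add_one_le_exp (x - Real.log q)) hq.le
    rwa [Real.exp_sub, Real.exp_log hq, mul_div_cancel₀ _ hq.ne'] at h

/-- The Donsker–Varadhan inequality, in its unnormalized form. -/
theorem integral_add_one_le_toReal_klDiv_add {Ω : Type*} [MeasurableSpace Ω] {Q R : Measure Ω}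
    [IsProbabilityMeasure Q] [IsProbabilityMeasure R]
    (h : InformationTheory.klDiv Q R ≠ ∞) {g : Ω → ℝ} (hg : Integrable g Q)
    (hexp : Integrable (fun u => Real.exp (g u)) R) :
    ∫ u, g u ∂ Q + 1 ≤ (InformationTheory.klDiv Q R).toReal + ∫ u, Real.exp (g u) ∂ R := by
  obtain ⟨hac, hllr⟩ := InformationTheory.klDiv_ne_top_iff.1 h
  rw [InformationTheory.toReal_klDiv_of_measure_eq hac (by simp)]
  have hint : Integrable (fun u => g u - llr Q R u + 1) Q := (hg.sub hllr).add (integrable_const 1)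
  have hle : ∫ u, (g u - llr Q R u + 1) ∂ Q ≤ ∫ u, Real.exp (g u) ∂ R := by
    -- Over `R` the claim becomes the pointwise Fenchel–Young inequality with `q = dQ/dR`.
    rw [← integral_rnDeriv_smul hac]
    exact integral_mono ((integrable_rnDeriv_smul_iff hac).2 hint) hexp fun u =>
      mul_sub_log_add_one_le_exp ENNReal.toReal_nonneg _
  rw [integral_add (f := fun u => g u - llr Q R u) (hg.sub hllr) (integrable_const 1),
    integral_sub hg hllr] at hle
  simp only [integral_const, probReal_univ, smul_eq_mul, mul_one] at hle
  linarith

/-- A linear family of measurable functions bounded by a multiple of the norm of the parameter. -/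
structure IsBoundedFamily {Ω V : Type*} [MeasurableSpace Ω] [NormedAddCommGroup V]
    [NormedSpace ℝ V] (F : V →ₗ[ℝ] Ω → ℝ) (C : ℝ) : Prop where
  measurable : ∀ v, Measurable (F v)
  abs_apply_le : ∀ v u, |F v u| ≤ C * ‖v‖

/-! ### Coercivity and attainment of the dual minimum over `θ ≤ 0`. -/

section BoundedFamily

variable {Ω V : Type*} [MeasurableSpace Ω] [NormedAddCommGroup V] [NormedSpace ℝ V]
  {F : V →ₗ[ℝ] Ω → ℝ} {C : ℝ}

theorem IsBoundedFamily.integrable (hF : IsBoundedFamily F C) (R : Measure Ω) [IsFiniteMeasure R]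
    (v : V) : Integrable (F v) R :=
  .of_bound (hF.measurable v).aestronglyMeasurable (C * ‖v‖) (ae_of_all _ (hF.abs_apply_le v))

theorem continuous_eval_of_finiteDimensional {Ω V : Type*} [NormedAddCommGroup V]
    [NormedSpace ℝ V] [FiniteDimensional ℝ V] (F : V →ₗ[ℝ] Ω → ℝ) (u : Ω) :
    Continuous fun v => F v u :=
  ((LinearMap.proj u).comp F : V →ₗ[ℝ] ℝ).continuous_of_finiteDimensional

/-- `θ ≤ 0 ≤ δ` gives `exp (θ δ) ≤ 1`, so no integrability of `δ` under `R` is needed. This is why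
the minimization is first restricted to `θ ≤ 0`. -/
theorem IsBoundedFamily.integrable_exp (hF : IsBoundedFamily F C) (R : Measure Ω)
    [IsFiniteMeasure R] {δ : Ω → ℝ≥0} (hδ : Measurable δ) {θ : ℝ} (hθ : θ ≤ 0) (v : V) :
    Integrable (fun u => Real.exp (θ * δ u + F v u)) R := by
  have := hF.measurable v
  refine .of_bound (by fun_prop) (Real.exp (C * ‖v‖)) (ae_of_all _ fun u => ?_)
  rw [Real.norm_eq_abs, Real.abs_exp]
  exact Real.exp_le_exp.2 (by
    nlinarith [(abs_le.1 (hF.abs_apply_le v u)).2, mul_nonneg (neg_nonneg.2 hθ) (δ u).coe_nonneg])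

/-- The dual objective of the entropy minimization problem, up to the constant `-1`; the features
are normalized by the reference measure `R`. -/
noncomputable def expObjective (R : Measure Ω) (δ : Ω → ℝ≥0) (D : ℝ≥0) (F : V →ₗ[ℝ] Ω → ℝ)
    (θ : ℝ) (v : V) : ℝ :=
  ∫ u, Real.exp (θ * δ u + F v u) ∂ R - θ * D - ∫ u, F v u ∂ R

theorem IsBoundedFamily.integrable_mul_posPart (hF : IsBoundedFamily F C) {R : Measure Ω}
    [IsFiniteMeasure R] {w : Ω → ℝ} (hw : Measurable w) (hw0 : ∀ u, 0 < w u) (hw1 : ∀ u, w u ≤ 1)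
    (v : V) : Integrable (fun u => w u * max (F v u) 0) R := by
  have := hF.measurable v
  refine ((hF.integrable R v).norm).mono (by fun_prop) (ae_of_all _ fun u => ?_)
  rw [Real.norm_eq_abs, abs_mul, abs_of_pos (hw0 u), abs_of_nonneg (le_max_right _ _), norm_norm,
    Real.norm_eq_abs]
  exact (mul_le_of_le_one_left (le_max_right _ _) (hw1 u)).trans
    (max_le (le_abs_self _) (abs_nonneg _))

/-- Convexity serves to get continuity: a finite convex function on a finite-dimensional space is
continuous. -/
theorem IsBoundedFamily.convexOn_integral_mul_posPart (hF : IsBoundedFamily F C) {R : Measure Ω}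
    [IsFiniteMeasure R] {w : Ω → ℝ} (hw : Measurable w) (hw0 : ∀ u, 0 < w u) (hw1 : ∀ u, w u ≤ 1) :
    ConvexOn ℝ Set.univ fun v => ∫ u, w u * max (F v u) 0 ∂ R := by
  have hint := hF.integrable_mul_posPart (R := R) hw hw0 hw1
  refine ⟨convex_univ, fun v _ v' _ a b ha hb _ => ?_⟩
  simp only [smul_eq_mul]
  rw [← integral_const_mul, ← integral_const_mul,
    ← integral_add ((hint v).const_mul a) ((hint v').const_mul b)]
  refine integral_mono (hint _) (((hint v).const_mul a).add ((hint v').const_mul b)) fun u => ?_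
  have h : max (F (a • v + b • v') u) 0 ≤ a * max (F v u) 0 + b * max (F v' u) 0 := by
    simp only [map_add, map_smul, Pi.add_apply, Pi.smul_apply, smul_eq_mul]
    refine max_le (add_le_add ?_ ?_) (by positivity)
    · exact mul_le_mul_of_nonneg_left (le_max_left _ _) ha
    · exact mul_le_mul_of_nonneg_left (le_max_left _ _) hb
  calc w u * max (F (a • v + b • v') u) 0
      ≤ w u * (a * max (F v u) 0 + b * max (F v' u) 0) := mul_le_mul_of_nonneg_left h (hw0 u).le
    _ = _ := by ring

/-- Modulo the kernel of the family, the functional `v ↦ ∫ w exp (F v) - ∫ F v` is coercive. -/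
theorem IsBoundedFamily.exists_coercive [FiniteDimensional ℝ V] (hF : IsBoundedFamily F C)
    {R : Measure Ω} [IsProbabilityMeasure R] (hinj : ∀ v, F v =ᵐ[R] 0 → v = 0)
    {w : Ω → ℝ} (hw : Measurable w) (hw0 : ∀ u, 0 < w u) (hw1 : ∀ u, w u ≤ 1) :
    ∃ c > 0, ∃ B, ∀ v,
      c * ‖v‖ - B ≤ ∫ u, w u * Real.exp (F v u) ∂ R - ∫ u, F v u ∂ R := by
  -- For `M ≥ 1`, `exp x ≥ M x⁺ - M log M`. Up to a constant, this replaces the exponential term by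
  -- the positively homogeneous `M A`, so it suffices to make `M A - E` positive on the unit sphere.
  set A : V → ℝ := fun v => ∫ u, w u * max (F v u) 0 ∂ R with hA
  have hpos := hF.integrable_mul_posPart (R := R) hw hw0 hw1
  have hA0 : ∀ v, 0 ≤ A v := fun v =>
    integral_nonneg fun u => mul_nonneg (hw0 u).le (le_max_right _ _)
  have hAc : Continuous A :=
    continuousOn_univ.1 ((hF.convexOn_integral_mul_posPart hw hw0 hw1).continuousOn isOpen_univ)
  let E : V →ₗ[ℝ] ℝ :=
    { toFun := fun v => ∫ u, F v u ∂ R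
      map_add' := fun v v' => by
        simp only [map_add, Pi.add_apply]
        exact integral_add (hF.integrable R v) (hF.integrable R v')
      map_smul' := fun a v => by
        simp only [map_smul, Pi.smul_apply, smul_eq_mul, RingHom.id_apply]
        exact integral_const_mul _ _ }
  have hEc : Continuous E := E.continuous_of_finiteDimensional
  have hE : ∀ v, E v = ∫ u, F v u ∂ R := fun v => rfl
  have hNc : ∀ n : ℕ, Continuous fun v => ((n : ℝ) + 1) * A v - E v := fun n => by fun_prop
  -- If `A v > 0`, a large `n` works. If `A v = 0`, then `F v ≤ 0` a.e.; as `F v` is not a.e. zero,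
  -- its mean is negative and `n = 0` works.
  have hcover : Metric.sphere (0 : V) 1 ⊆ ⋃ n : ℕ, {v | 0 < ((n : ℝ) + 1) * A v - E v} := by
    intro v hv
    have hv0 : v ≠ 0 := by rintro rfl; simp at hv
    rw [Set.mem_iUnion]
    rcases (hA0 v).eq_or_lt with h0 | h0
    · refine ⟨0, ?_⟩
      have h1 := (integral_eq_zero_iff_of_nonneg
        (fun u => mul_nonneg (hw0 u).le (le_max_right _ _)) (hpos v)).1 h0.symm
      have h2 : 0 ≤ᵐ[R] fun u => -F v u := by
        filter_upwards [h1] with u hu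
        have : max (F v u) 0 = 0 := (mul_eq_zero.1 hu).resolve_left (hw0 u).ne'
        simpa using this
      have h3 : E v ≠ 0 := fun h => hv0 (hinj v (by
        have h4 := (integral_eq_zero_iff_of_nonneg_ae h2 (hF.integrable R v).neg).1 (by
          simp only [integral_neg, ← hE, h, neg_zero])
        filter_upwards [h4] with u hu
        simpa using hu))
      have h5 : 0 ≤ -E v := by
        rw [hE, ← integral_neg]
        exact integral_nonneg_of_ae h2
      have h6 : 0 < -E v := lt_of_le_of_ne h5 (by simpa using h3)
      simpa [← h0] using h6
    · obtain ⟨n, hn⟩ := exists_nat_gt (E v / A v)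
      refine ⟨n, ?_⟩
      rw [div_lt_iff₀ h0] at hn
      simp only [Set.mem_ofPred_eq]
      linarith
  -- The sets increase with `n` because `A ≥ 0`, so compactness gives one `n` for the whole sphere.
  obtain ⟨n, hn⟩ := (isCompact_sphere (0 : V) 1).elim_directed_cover _
    (fun n => isOpen_lt continuous_const (hNc n)) hcover
    (Monotone.directed_le fun m n hmn v (hv : 0 < ((m : ℝ) + 1) * A v - E v) =>
      show 0 < ((n : ℝ) + 1) * A v - E v from hv.trans_le (by
        have : (m : ℝ) ≤ n := by exact_mod_cast hmn
        nlinarith [hA0 v]))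
  obtain ⟨c, hc0, hc⟩ := (isCompact_sphere (0 : V) 1).exists_forall_le'
    (hNc n).continuousOn (a := 0) hn
  set M : ℝ := (n : ℝ) + 1 with hM
  have hM1 : 1 ≤ M := by simp [hM]
  have hlog : 0 ≤ M * Real.log M := mul_nonneg (by linarith) (Real.log_nonneg hM1)
  have hAs : ∀ (t : ℝ) v, 0 ≤ t → A (t • v) = t * A v := fun t v ht => by
    simp only [hA, ← integral_const_mul]
    congr 1
    ext u
    simp only [map_smul, Pi.smul_apply, smul_eq_mul]
    rw [show max (t * F v u) 0 = t * max (F v u) 0 by rw [mul_max_of_nonneg _ _ ht, mul_zero]]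
    ring
  have hN : ∀ v, c * ‖v‖ ≤ M * A v - E v := fun v => by
    rcases eq_or_ne v 0 with rfl | hv
    · have := hAs 0 0 le_rfl
      simp only [smul_zero, zero_mul] at this
      simp [this]
    · have hv' : 0 < ‖v‖ := norm_pos_iff.2 hv
      have h1 := hc (‖v‖⁻¹ • v) (by simp [norm_smul, hv'.ne'])
      simp only [hAs _ v (inv_nonneg.2 hv'.le), map_smul, smul_eq_mul] at h1
      calc c * ‖v‖ ≤ (M * (‖v‖⁻¹ * A v) - ‖v‖⁻¹ * E v) * ‖v‖ :=
            mul_le_mul_of_nonneg_right h1 hv'.le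
        _ = M * A v - E v := by field_simp
  refine ⟨c, hc0, M * Real.log M, fun v => ?_⟩
  have hexp : Integrable (fun u => w u * Real.exp (F v u)) R := by
    have := hF.measurable v
    refine .of_bound (by fun_prop) (Real.exp (C * ‖v‖)) (ae_of_all _ fun u => ?_)
    rw [Real.norm_eq_abs, abs_mul, abs_of_pos (hw0 u), Real.abs_exp]
    exact (mul_le_of_le_one_left (Real.exp_pos _).le (hw1 u)).trans
      (Real.exp_le_exp.2 (abs_le.1 (hF.abs_apply_le v u)).2)
  have hle : M * A v - M * Real.log M ≤ ∫ u, w u * Real.exp (F v u) ∂ R := by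
    have : M * A v - M * Real.log M
        = ∫ u, (M * (w u * max (F v u) 0) - M * Real.log M) ∂ R := by
      rw [integral_sub ((hpos v).const_mul M) (integrable_const _), integral_const_mul]
      simp [hA]
    rw [this]
    refine integral_mono (((hpos v).const_mul M).sub (integrable_const _)) hexp fun u => ?_
    have h1 : M * max (F v u) 0 - M * Real.log M ≤ Real.exp (F v u) := by
      rcases le_total (F v u) 0 with h | h
      · rw [max_eq_right h]
        linarith [Real.exp_pos (F v u)]
      · rw [max_eq_left h]
        have := mul_sub_log_add_one_le_exp (by linarith : 0 ≤ M) (F v u)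
        nlinarith
    have h2 := mul_le_mul_of_nonneg_left h1 (hw0 u).le
    have h3 := mul_le_of_le_one_left hlog (hw1 u)
    simp only
    nlinarith
  have := hN v
  rw [hE] at this
  linarith

/-- Dominated convergence: on this set the exponent is at most `C * r`, whatever `δ` is. -/
theorem IsBoundedFamily.continuousOn_expObjective [FiniteDimensional ℝ V]
    (hF : IsBoundedFamily F C) (hC : 0 ≤ C) {R : Measure Ω} [IsProbabilityMeasure R] {δ : Ω → ℝ≥0}
    (hδ : Measurable δ) (D : ℝ≥0) (T r : ℝ) :
    ContinuousOn (fun p : ℝ × V => expObjective R δ D F p.1 p.2)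
      (Set.Icc (-T) 0 ×ˢ Metric.closedBall 0 r) := by
  have hbd : ∀ p ∈ Set.Icc (-T) 0 ×ˢ Metric.closedBall (0 : V) r, ∀ u,
      |F p.2 u| ≤ C * r := fun p hp u =>
    (hF.abs_apply_le _ u).trans (mul_le_mul_of_nonneg_left (mem_closedBall_zero_iff.1 hp.2) hC)
  have hev : ∀ u, Continuous fun v => F v u := continuous_eval_of_finiteDimensional F
  unfold expObjective
  refine ContinuousOn.sub (ContinuousOn.sub ?_ (by fun_prop)) ?_
  · refine continuousOn_of_dominated (bound := fun _ => Real.exp (C * r)) (fun p hp => ?_)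
      (fun p hp => ae_of_all _ fun u => ?_) (integrable_const _) (ae_of_all _ fun u => ?_)
    · have := hF.measurable p.2
      fun_prop
    · rw [Real.norm_eq_abs, Real.abs_exp]
      exact Real.exp_le_exp.2 (by
        nlinarith [(abs_le.1 (hbd p hp u)).2, mul_nonneg (neg_nonneg.2 hp.1.2) (δ u).coe_nonneg])
    · have := hev u
      exact Continuous.continuousOn (by fun_prop)
  · refine continuousOn_of_dominated (bound := fun _ => C * r) (fun p hp => ?_)
      (fun p hp => ae_of_all _ fun u => hbd p hp u) (integrable_const _) (ae_of_all _ fun u => ?_)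
    · exact (hF.measurable p.2).aestronglyMeasurable
    · have := hev u
      exact Continuous.continuousOn (by fun_prop)

/-- A measure of finite divergence that satisfies the feature constraints bounds the objective
from below, linearly in the multiplier of `δ`. -/
theorem IsBoundedFamily.le_expObjective (hF : IsBoundedFamily F C) {R Q : Measure Ω}
    [IsProbabilityMeasure R] [IsProbabilityMeasure Q] {δ : Ω → ℝ≥0} (hδ : Measurable δ) (D : ℝ≥0)
    (hkl : InformationTheory.klDiv Q R ≠ ∞) (hmom : ∀ v, ∫ u, F v u ∂ Q = ∫ u, F v u ∂ R)
    (hint : Integrable (fun u => (δ u : ℝ)) Q) {θ : ℝ} (hθ : θ ≤ 0) (v : V) :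
    1 - (InformationTheory.klDiv Q R).toReal + θ * (∫ u, (δ u : ℝ) ∂ Q - D)
      ≤ expObjective R δ D F θ v := by
  have h := integral_add_one_le_toReal_klDiv_add hkl ((hint.const_mul θ).add (hF.integrable Q v))
    (hF.integrable_exp R hδ hθ v)
  simp only [Pi.add_apply] at h
  rw [integral_add (hint.const_mul θ) (hF.integrable Q v), integral_const_mul, hmom] at h
  unfold expObjective
  linarith

theorem expObjective_zero_zero {R : Measure Ω} [IsProbabilityMeasure R] (δ : Ω → ℝ≥0) (D : ℝ≥0) :
    expObjective R δ D F 0 0 = 1 := by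
  simp [expObjective]

/-- Outside a compact set the objective is at least `1`, its value at the origin, so the minimum
over the compact set is global on `θ ≤ 0`. -/
theorem IsBoundedFamily.exists_isMin_expObjective_of_injective [FiniteDimensional ℝ V]
    (hF : IsBoundedFamily F C) (hC : 0 ≤ C) {R Q : Measure Ω}
    [IsProbabilityMeasure R] [IsProbabilityMeasure Q] (hinj : ∀ v, F v =ᵐ[R] 0 → v = 0)
    {δ : Ω → ℝ≥0} (hδ : Measurable δ) {D : ℝ≥0}
    (hkl : InformationTheory.klDiv Q R ≠ ∞) (hmom : ∀ v, ∫ u, F v u ∂ Q = ∫ u, F v u ∂ R)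
    (hint : Integrable (fun u => (δ u : ℝ)) Q) (hlt : ∫ u, (δ u : ℝ) ∂ Q < D) :
    ∃ θ ≤ 0, ∃ v, ∀ θ' ≤ 0, ∀ v', expObjective R δ D F θ v ≤ expObjective R δ D F θ' v' := by
  set κ := (InformationTheory.klDiv Q R).toReal
  have hκ : 0 ≤ κ := ENNReal.toReal_nonneg
  have hgap : 0 < (D : ℝ) - ∫ u, (δ u : ℝ) ∂ Q := sub_pos.2 hlt
  -- `T` is chosen so that the linear lower bound `1 - κ - θ (D - ∫ δ dQ)` reaches `1` at `θ = -T`.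
  set T := κ / ((D : ℝ) - ∫ u, (δ u : ℝ) ∂ Q) with hT
  have hT0 : 0 ≤ T := div_nonneg hκ hgap.le
  -- For `θ ∈ [-T, 0]` the factor `exp (θ δ)` is at least `exp (-T δ)`, so this single weight gives
  -- coercivity uniformly in `θ`.
  obtain ⟨c, hc, B, hB⟩ := hF.exists_coercive hinj (R := R) (w := fun u => Real.exp (-T * δ u))
    (by fun_prop) (fun u => Real.exp_pos _) (fun u => Real.exp_le_one_iff.2 (by
      nlinarith [(δ u).coe_nonneg]))
  set r := max 0 ((B + 1) / c)
  set K := Set.Icc (-T) 0 ×ˢ Metric.closedBall (0 : V) r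
  have h0K : ((0 : ℝ), (0 : V)) ∈ K :=
    ⟨⟨by simpa using hT0, le_rfl⟩, by simp [r]⟩
  obtain ⟨p, hpK, hp⟩ := (isCompact_Icc.prod (isCompact_closedBall (0 : V) r)).exists_isMinOn
    ⟨_, h0K⟩ (hF.continuousOn_expObjective hC hδ D T r (R := R))
  refine ⟨p.1, hpK.1.2, p.2, fun θ hθ v => ?_⟩
  by_cases hmem : (θ, v) ∈ K
  · exact hp hmem
  refine (hp h0K).trans ?_
  change expObjective R δ D F 0 0 ≤ _
  rw [expObjective_zero_zero]
  rcases lt_or_ge θ (-T) with hθT | hθT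
  · have h1 := hF.le_expObjective hδ D hkl hmom hint hθ v
    have h2 : T * ((D : ℝ) - ∫ u, (δ u : ℝ) ∂ Q) = κ := div_mul_cancel₀ _ hgap.ne'
    nlinarith
  · have hv : r < ‖v‖ := by
      by_contra! h
      exact hmem ⟨⟨hθT, hθ⟩, by simpa using h⟩
    have hv' : B + 1 < c * ‖v‖ := by
      have := (le_max_right 0 ((B + 1) / c)).trans_lt hv
      rwa [div_lt_iff₀' hc] at this
    have h1 : ∫ u, Real.exp (-T * δ u) * Real.exp (F v u) ∂ R
        ≤ ∫ u, Real.exp (θ * δ u + F v u) ∂ R := by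
      simp only [← Real.exp_add]
      refine integral_mono (hF.integrable_exp R hδ (by linarith) v)
        (hF.integrable_exp R hδ hθ v) fun u => Real.exp_le_exp.2 ?_
      nlinarith [(δ u).coe_nonneg]
    have h2 := hB v
    have h3 : 0 ≤ -θ * D := mul_nonneg (by linarith) D.coe_nonneg
    unfold expObjective
    linarith

/-- The objective restricted to nonpositive multipliers of `δ` attains its minimum. -/
theorem IsBoundedFamily.exists_isMin_expObjective [FiniteDimensional ℝ V]
    (hF : IsBoundedFamily F C) (hC : 0 ≤ C) {R Q : Measure Ω}
    [IsProbabilityMeasure R] [IsProbabilityMeasure Q]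
    {δ : Ω → ℝ≥0} (hδ : Measurable δ) {D : ℝ≥0}
    (hkl : InformationTheory.klDiv Q R ≠ ∞) (hmom : ∀ v, ∫ u, F v u ∂ Q = ∫ u, F v u ∂ R)
    (hint : Integrable (fun u => (δ u : ℝ)) Q) (hlt : ∫ u, (δ u : ℝ) ∂ Q < D) :
    ∃ θ ≤ 0, ∃ v, ∀ θ' ≤ 0, ∀ v', expObjective R δ D F θ v ≤ expObjective R δ D F θ' v' := by
  let K : Submodule ℝ V :=
    { carrier := {v | F v =ᵐ[R] 0}
      zero_mem' := by simp
      add_mem' := fun {a b} ha hb => by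
        change F (a + b) =ᵐ[R] 0
        filter_upwards [show F a =ᵐ[R] 0 from ha, show F b =ᵐ[R] 0 from hb] with u hu hu'
        simp [hu, hu']
      smul_mem' := fun c a ha => by
        change F (c • a) =ᵐ[R] 0
        filter_upwards [show F a =ᵐ[R] 0 from ha] with u hu
        simp [hu] }
  -- The objective does not change along the kernel `K`, so minimizing over a complement loses
  -- nothing.
  obtain ⟨W, hW⟩ := K.exists_isCompl
  have hFW : IsBoundedFamily (F.comp W.subtype) C :=
    ⟨fun v => hF.measurable _, fun v u => hF.abs_apply_le _ u⟩
  obtain ⟨θ, hθ, v, hv⟩ := hFW.exists_isMin_expObjective_of_injective hC (R := R) (Q := Q)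
    (fun v hv => by
      have h1 : (v : V) ∈ K ⊓ W := ⟨hv, v.2⟩
      rw [hW.inf_eq_bot] at h1
      exact Subtype.ext h1) hδ hkl (fun v => hmom _) hint hlt
  refine ⟨θ, hθ, v, fun θ' hθ' v' => ?_⟩
  obtain ⟨k, hk, w, hw, rfl⟩ := Submodule.mem_sup.1 (hW.sup_eq_top ▸ Submodule.mem_top : v' ∈ K ⊔ W)
  have hkw : F (k + w) =ᵐ[R] F w := by
    have hk' : F k =ᵐ[R] 0 := hk
    filter_upwards [hk'] with u hu
    simp [hu]
  refine (hv θ' hθ' ⟨w, hw⟩).trans_eq ?_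
  simp only [expObjective, LinearMap.comp_apply, Submodule.subtype_apply]
  congr 1
  · congr 1
    refine integral_congr_ae ?_
    filter_upwards [hkw] with u hu
    rw [hu]
  · exact integral_congr_ae hkw.symm

/-! ### Strict negativity of the multiplier of `δ`. -/

/-- If `∫ δ > D`, then `∫ exp (-ε δ) + ε D < 1` for some `ε > 0`. -/
theorem exists_integral_exp_neg_mul_add_lt {R : Measure Ω} [IsProbabilityMeasure R]
    {δ : Ω → ℝ≥0} (hδ : Measurable δ) {D : ℝ≥0} (hD : (D : ℝ≥0∞) < ∫⁻ u, δ u ∂ R) :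
    ∃ ε : ℝ, 0 < ε ∧ ∫ u, Real.exp (-ε * δ u) ∂ R + ε * D < 1 := by
  have hsup : ∫⁻ u, δ u ∂ R = ⨆ n : ℕ, ∫⁻ u, ((min (δ u) n : ℝ≥0) : ℝ≥0∞) ∂ R := by
    rw [← lintegral_iSup (f := fun (n : ℕ) u => ((min (δ u) n : ℝ≥0) : ℝ≥0∞))
      (fun n => by fun_prop) (fun m n hmn u =>
      ENNReal.coe_le_coe.2 (min_le_min_left _ (Nat.mono_cast hmn : (m : ℝ≥0) ≤ n)))]
    refine lintegral_congr fun u => le_antisymm ?_ (iSup_le fun n => by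
      exact_mod_cast min_le_left _ _)
    obtain ⟨n, hn⟩ := exists_nat_ge (δ u)
    exact le_iSup_of_le n (by rw [min_eq_left hn])
  rw [hsup] at hD
  obtain ⟨n, hn⟩ := lt_iSup_iff.1 hD
  -- Truncation handles `∫ δ = ∞`: some `min δ n` already has mean above `D`.
  set X : Ω → ℝ := fun u => ((min (δ u) n : ℝ≥0) : ℝ) with hX
  have hX0 : ∀ u, 0 ≤ X u := fun u => NNReal.coe_nonneg _
  have hXδ : ∀ u, X u ≤ δ u := fun u => by exact_mod_cast min_le_left _ _
  have hXn : ∀ u, X u ≤ n := fun u => by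
    have : min (δ u) (n : ℝ≥0) ≤ n := min_le_right _ _
    exact_mod_cast this
  have hXm : Measurable X := by fun_prop
  have hXi : Integrable X R := .of_bound hXm.aestronglyMeasurable n (ae_of_all _ fun u => by
    rw [Real.norm_eq_abs, abs_of_nonneg (hX0 u)]; exact hXn u)
  have hlt : (D : ℝ) < ∫ u, X u ∂ R := by
    have h1 : ENNReal.ofReal (∫ u, X u ∂ R) = ∫⁻ u, ((min (δ u) n : ℝ≥0) : ℝ≥0∞) ∂ R := by
      rw [ofReal_integral_eq_lintegral_ofReal hXi (ae_of_all _ hX0)]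
      exact lintegral_congr fun u => ENNReal.ofReal_coe_nnreal
    rw [← h1, ← ENNReal.ofReal_coe_nnreal] at hn
    exact (ENNReal.ofReal_lt_ofReal_iff_of_nonneg D.coe_nonneg).1 hn
  set a := ∫ u, X u ∂ R
  have hDn : 0 ≤ (D : ℝ) * n := by positivity
  -- Since `exp (-ε X) ≤ 1 / (1 + ε X) ≤ 1 - ε X / (1 + ε n)`, it suffices that `D (1 + ε n) < a`.
  -- The `+ 1` keeps the denominator positive when `D n = 0`.
  obtain ⟨ε, hε⟩ : ∃ ε : ℝ, ε = (a - D) / (2 * (D * n + 1)) := ⟨_, rfl⟩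
  have hε0 : 0 < ε := hε ▸ div_pos (by linarith) (by linarith)
  have hεn : 0 < 1 + ε * n := by positivity
  refine ⟨ε, hε0, ?_⟩
  have hle : ∫ u, Real.exp (-ε * δ u) ∂ R ≤ 1 - ε / (1 + ε * n) * a := by
    have : 1 - ε / (1 + ε * n) * a = ∫ u, (1 - ε / (1 + ε * n) * X u) ∂ R := by
      rw [integral_sub (integrable_const _) (hXi.const_mul _), integral_const_mul]
      simp [a]
    rw [this]
    refine integral_mono (.of_bound (by fun_prop) 1 (ae_of_all _ fun u => ?_))
      ((integrable_const _).sub (hXi.const_mul _)) fun u => ?_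
    · rw [Real.norm_eq_abs, Real.abs_exp]
      exact Real.exp_le_one_iff.2 (by nlinarith [(δ u).coe_nonneg])
    · have hεX : 0 ≤ ε * X u := mul_nonneg hε0.le (hX0 u)
      have h1 : Real.exp (-ε * δ u) ≤ Real.exp (-(ε * X u)) :=
        Real.exp_le_exp.2 (by nlinarith [hXδ u])
      have h2 : Real.exp (-(ε * X u)) ≤ (1 + ε * X u)⁻¹ := by
        rw [Real.exp_neg]
        exact inv_anti₀ (by positivity) (by linarith [Real.add_one_le_exp (ε * X u)])
      have h3 : (1 + ε * X u)⁻¹ ≤ 1 - ε / (1 + ε * n) * X u := by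
        have : (1 + ε * X u)⁻¹ = 1 - ε * X u / (1 + ε * X u) := by field_simp; ring
        rw [this, div_mul_eq_mul_div]
        refine sub_le_sub_left (div_le_div_of_nonneg_left hεX (add_pos_of_pos_of_nonneg one_pos hεX) ?_) _
        nlinarith [hXn u]
      exact h1.trans (h2.trans h3)
  have hfin : (D : ℝ) * (1 + ε * n) < a := by
    have : ε * (D * n + 1) = (a - D) / 2 := by rw [hε]; field_simp
    nlinarith
  have : ε * D < ε / (1 + ε * n) * a := by
    rw [div_mul_eq_mul_div ε (1 + ε * n), lt_div_iff₀ hεn]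
    nlinarith
  linarith

/-- When `D` lies strictly below the mean of `δ`, the minimizing multiplier of `δ` is negative. -/
theorem IsBoundedFamily.neg_of_isMin_expObjective (hF : IsBoundedFamily F C) {R : Measure Ω}
    [IsProbabilityMeasure R] {δ : Ω → ℝ≥0} (hδ : Measurable δ) {D : ℝ≥0}
    (hD : (D : ℝ≥0∞) < ∫⁻ u, δ u ∂ R) {θ : ℝ} (hθ : θ ≤ 0) {v : V}
    (hmin : ∀ θ' ≤ 0, ∀ v', expObjective R δ D F θ v ≤ expObjective R δ D F θ' v') : θ < 0 := by
  refine lt_of_le_of_ne hθ ?_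
  rintro rfl
  obtain ⟨ε, hε, hlt⟩ := exists_integral_exp_neg_mul_add_lt hδ hD
  have h1 := hmin (-ε) (by linarith) 0
  have h2 : 1 ≤ expObjective R δ D F 0 v := by
    unfold expObjective
    have h3 : ∫ u, (F v u + 1) ∂ R ≤ ∫ u, Real.exp (0 * δ u + F v u) ∂ R :=
      integral_mono ((hF.integrable R v).add (integrable_const 1))
        (hF.integrable_exp R hδ le_rfl v) fun u => by
          simpa using Real.add_one_le_exp (F v u)
    rw [integral_add (hF.integrable R v) (integrable_const 1)] at h3
    simp only [integral_const, probReal_univ, smul_eq_mul, mul_one] at h3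
    linarith
  have h4 : expObjective R δ D F (-ε) 0 = ∫ u, Real.exp (-ε * δ u) ∂ R + ε * D := by
    simp [expObjective]
  linarith

/-! ### First-order conditions at the minimum. -/

/-- Fermat's rule for the moment generating function with a linear perturbation. -/
theorem integral_eq_of_isLocalMin_mgf_sub {Q : Measure Ω} {X : Ω → ℝ} {c : ℝ}
    (hX : 0 ∈ interior (integrableExpSet X Q))
    (hmin : IsLocalMin (fun t => mgf X Q t - t * c) 0) : ∫ u, X u ∂ Q = c := by
  have h1 := hasDerivAt_mgf hX
  have h2 : HasDerivAt (fun t : ℝ => t * c) c 0 := by simpa using (hasDerivAt_id (0 : ℝ)).mul_const c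
  have h3 := hmin.hasDerivAt_eq_zero (h1.sub h2)
  simpa [sub_eq_zero] using h3

/-- Along a line in the direction `X`, the exponential integral is the moment generating function of
`X` under the tilted measure, so its derivative at `0` is the tilted mean. -/
theorem mgf_withDensity_exp {R : Measure Ω} {g X : Ω → ℝ} (hg : Measurable g) (t : ℝ) :
    mgf X (R.withDensity fun u => ENNReal.ofReal (Real.exp (g u))) t
      = ∫ u, Real.exp (g u + t * X u) ∂ R := by
  rw [mgf, integral_withDensity_eq_integral_toReal_smul (by fun_prop)
    (ae_of_all _ fun u => ENNReal.ofReal_lt_top)]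
  simp [ENNReal.toReal_ofReal (Real.exp_pos _).le, Real.exp_add]

theorem mem_integrableExpSet_withDensity_exp {R : Measure Ω} {g X : Ω → ℝ} (hg : Measurable g)
    {t : ℝ} : t ∈ integrableExpSet X (R.withDensity fun u => ENNReal.ofReal (Real.exp (g u)))
      ↔ Integrable (fun u => Real.exp (g u + t * X u)) R := by
  rw [integrableExpSet, Set.mem_ofPred_eq, integrable_withDensity_iff_integrable_smul'
    (by fun_prop) (ae_of_all _ fun u => ENNReal.ofReal_lt_top)]
  simp [ENNReal.toReal_ofReal (Real.exp_pos _).le, Real.exp_add]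

theorem IsBoundedFamily.integral_eq_of_isMin_expObjective (hF : IsBoundedFamily F C)
    {R : Measure Ω} [IsProbabilityMeasure R] {δ : Ω → ℝ≥0} (hδ : Measurable δ) {D : ℝ≥0} {θ : ℝ}
    (hθ : θ ≤ 0) {v : V}
    (hmin : ∀ θ' ≤ 0, ∀ v', expObjective R δ D F θ v ≤ expObjective R δ D F θ' v') (x : V) :
    ∫ u, F x u ∂(R.withDensity fun u => ENNReal.ofReal (Real.exp (θ * δ u + F v u)))
      = ∫ u, F x u ∂ R := by
  have hv := hF.measurable v
  have hlin : ∀ (t : ℝ) u, θ * δ u + F v u + t * F x u = θ * δ u + F (v + t • x) u := fun t u => by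
    simp only [map_add, map_smul, Pi.add_apply, Pi.smul_apply, smul_eq_mul]
    ring
  refine integral_eq_of_isLocalMin_mgf_sub ?_ (Filter.Eventually.of_forall fun t => ?_)
  · refine interior_mono (s := Set.univ) (fun t _ => ?_) (by simp)
    rw [mem_integrableExpSet_withDensity_exp (by fun_prop)]
    simp only [hlin]
    exact hF.integrable_exp R hδ hθ _
  · have h := hmin θ hθ (v + t • x)
    simp only [mgf_withDensity_exp (X := F x) (g := fun u => θ * δ u + F v u) (by fun_prop)]
    simp only [hlin]
    unfold expObjective at h
    have h2 : ∫ u, F (v + t • x) u ∂ R = ∫ u, F v u ∂ R + t * ∫ u, F x u ∂ R := by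
      simp only [map_add, map_smul, Pi.add_apply, Pi.smul_apply, smul_eq_mul]
      rw [integral_add (hF.integrable R v) ((hF.integrable R x).const_mul t), integral_const_mul]
    rw [h2] at h
    simp only [zero_smul, add_zero, zero_mul, sub_zero]
    linarith

/-- Strictness of `θ < 0` is what matters: `θ + t ≤ 0` for all `t` near `0`, so the minimum is
two-sided in this direction. -/
theorem IsBoundedFamily.integral_distortion_eq_of_isMin_expObjective (hF : IsBoundedFamily F C)
    {R : Measure Ω} [IsProbabilityMeasure R] {δ : Ω → ℝ≥0} (hδ : Measurable δ) {D : ℝ≥0} {θ : ℝ}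
    (hθ : θ < 0) {v : V}
    (hmin : ∀ θ' ≤ 0, ∀ v', expObjective R δ D F θ v ≤ expObjective R δ D F θ' v') :
    ∫ u, (δ u : ℝ) ∂(R.withDensity fun u => ENNReal.ofReal (Real.exp (θ * δ u + F v u))) = D := by
  have hv := hF.measurable v
  have hlin : ∀ (t : ℝ) u, θ * δ u + F v u + t * δ u = (θ + t) * δ u + F v u := fun t u => by ring
  have hnhds : Set.Iic (-θ) ∈ nhds (0 : ℝ) := Iic_mem_nhds (by linarith)
  refine integral_eq_of_isLocalMin_mgf_sub ?_ ?_
  · rw [mem_interior_iff_mem_nhds]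
    filter_upwards [hnhds] with t ht
    rw [mem_integrableExpSet_withDensity_exp (by fun_prop)]
    simp only [hlin]
    exact hF.integrable_exp R hδ (by linarith [Set.mem_Iic.1 ht]) _
  · filter_upwards [hnhds] with t ht
    have h := hmin (θ + t) (by linarith [Set.mem_Iic.1 ht]) v
    simp only [mgf_withDensity_exp (X := fun u => (δ u : ℝ)) (g := fun u => θ * δ u + F v u)
      (by fun_prop)]
    simp only [hlin]
    unfold expObjective at h
    simp only [add_zero, zero_mul, sub_zero]
    linarith

end BoundedFamily

/-! ### Optimality and rigidity of exponential densities. -/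

section ExponentialDensity

variable {Ω : Type*} [MeasurableSpace Ω] {R : Measure Ω} {g : Ω → ℝ}

theorem integral_withDensity_exp (hg : Measurable g) (f : Ω → ℝ) :
    ∫ u, f u ∂(R.withDensity fun u => ENNReal.ofReal (Real.exp (g u)))
      = ∫ u, Real.exp (g u) * f u ∂ R := by
  rw [integral_withDensity_eq_integral_toReal_smul (by fun_prop)
    (ae_of_all _ fun u => ENNReal.ofReal_lt_top)]
  simp [ENNReal.toReal_ofReal (Real.exp_pos _).le]

theorem integrable_withDensity_exp (hg : Measurable g) {f : Ω → ℝ} :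
    Integrable f (R.withDensity fun u => ENNReal.ofReal (Real.exp (g u)))
      ↔ Integrable (fun u => Real.exp (g u) * f u) R := by
  rw [integrable_withDensity_iff_integrable_smul' (by fun_prop)
    (ae_of_all _ fun u => ENNReal.ofReal_lt_top)]
  simp [ENNReal.toReal_ofReal (Real.exp_pos _).le]

theorem llr_withDensity_exp [SigmaFinite R] (hg : Measurable g) :
    llr (R.withDensity fun u => ENNReal.ofReal (Real.exp (g u))) R
      =ᵐ[R.withDensity fun u => ENNReal.ofReal (Real.exp (g u))] g := by
  have h := Measure.rnDeriv_withDensity R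
    (f := fun u => ENNReal.ofReal (Real.exp (g u))) (by fun_prop)
  filter_upwards [(withDensity_absolutelyContinuous R _).ae_le h] with u hu
  rw [llr, hu, ENNReal.toReal_ofReal (Real.exp_pos _).le, Real.log_exp]

/-- A probability measure with density `exp g` minimizes the divergence among the probability
measures under which `g` has the same mean. -/
theorem klDiv_withDensity_exp_le [IsProbabilityMeasure R] (hg : Measurable g)
    [IsProbabilityMeasure (R.withDensity fun u => ENNReal.ofReal (Real.exp (g u)))]
    (hint : Integrable g (R.withDensity fun u => ENNReal.ofReal (Real.exp (g u))))
    {Q : Measure Ω} [IsProbabilityMeasure Q] (hgQ : Integrable g Q)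
    (hmean : ∫ u, g u ∂ Q = ∫ u, g u ∂(R.withDensity fun u => ENNReal.ofReal (Real.exp (g u)))) :
    InformationTheory.klDiv (R.withDensity fun u => ENNReal.ofReal (Real.exp (g u))) R
      ≤ InformationTheory.klDiv Q R := by
  set Q₀ := R.withDensity fun u => ENNReal.ofReal (Real.exp (g u)) with hQ₀
  rcases eq_or_ne (InformationTheory.klDiv Q R) ∞ with h | h
  · rw [h]
    exact le_top
  have hac : Q₀ ≪ R := withDensity_absolutelyContinuous R _
  have hllr : llr Q₀ R =ᵐ[Q₀] g := llr_withDensity_exp hg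
  have hne : InformationTheory.klDiv Q₀ R ≠ ∞ :=
    InformationTheory.klDiv_ne_top hac (hint.congr hllr.symm)
  have hone : Integrable (fun _ => (1 : ℝ)) Q₀ := integrable_const 1
  rw [hQ₀, integrable_withDensity_exp hg] at hone
  have hmass : ∫ u, Real.exp (g u) ∂ R = 1 := by
    have := integral_withDensity_exp hg (R := R) (fun _ => (1 : ℝ))
    rw [← hQ₀] at this
    simpa using this.symm
  -- Because `∫ exp g dR = 1`, this bounds the divergence of `Q` below by the mean of `g`, which is
  -- the divergence of `Q₀`.
  have hDV := integral_add_one_le_toReal_klDiv_add h hgQ (by simpa using hone)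
  rw [hmass, hmean] at hDV
  rw [← ENNReal.toReal_le_toReal hne h,
    InformationTheory.toReal_klDiv_of_measure_eq hac (by simp), integral_congr_ae hllr]
  linarith

/-- Convexity of the exponential, integrated: the tangent inequality at `g`. -/
theorem integral_sub_le_integral_exp_sub [IsFiniteMeasure R] (hg : Measurable g) {g' : Ω → ℝ}
    (hexp : Integrable (fun u => Real.exp (g u)) R)
    (hexp' : Integrable (fun u => Real.exp (g' u)) R)
    (hint : Integrable (fun u => g' u - g u)
      (R.withDensity fun u => ENNReal.ofReal (Real.exp (g u)))) :
    ∫ u, (g' u - g u) ∂(R.withDensity fun u => ENNReal.ofReal (Real.exp (g u)))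
        ≤ ∫ u, Real.exp (g' u) ∂ R - ∫ u, Real.exp (g u) ∂ R ∧
      (∫ u, Real.exp (g' u) ∂ R - ∫ u, Real.exp (g u) ∂ R
        ≤ ∫ u, (g' u - g u) ∂(R.withDensity fun u => ENNReal.ofReal (Real.exp (g u))) →
        g' =ᵐ[R] g) := by
  rw [integrable_withDensity_exp hg] at hint
  rw [integral_withDensity_exp hg]
  have hnn : ∀ u, 0 ≤ Real.exp (g' u) - Real.exp (g u) - Real.exp (g u) * (g' u - g u) := fun u => by
    have h1 := mul_le_mul_of_nonneg_left (Real.add_one_le_exp (g' u - g u)) (Real.exp_pos (g u)).le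
    rw [← Real.exp_add, add_sub_cancel] at h1
    linarith
  have hi := (hexp'.sub hexp).sub hint
  have heq : ∫ u, (Real.exp (g' u) - Real.exp (g u) - Real.exp (g u) * (g' u - g u)) ∂ R
      = ∫ u, Real.exp (g' u) ∂ R - ∫ u, Real.exp (g u) ∂ R
        - ∫ u, Real.exp (g u) * (g' u - g u) ∂ R := by
    rw [← integral_sub hexp' hexp]
    exact integral_sub (hexp'.sub hexp) hint
  have h0 := integral_nonneg_of_ae (μ := R) (ae_of_all _ hnn)
  refine ⟨by linarith, fun hle => ?_⟩
  -- Equality makes the nonnegative convexity defect vanish a.e.; strictness of `1 + x < exp x` for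
  -- `x ≠ 0` then forces `g' = g`.
  have hz := (integral_eq_zero_iff_of_nonneg_ae (ae_of_all _ hnn) hi).1 (by linarith)
  filter_upwards [hz] with u hu
  by_contra hne
  have h1 := mul_lt_mul_of_pos_left (Real.add_one_lt_exp (sub_ne_zero.2 hne)) (Real.exp_pos (g u))
  rw [← Real.exp_add, add_sub_cancel] at h1
  simp only [Pi.zero_apply] at hu
  linarith

end ExponentialDensity

/-! ### Moment features on the cube. -/

/-- The linear family `μ + ∑ ν_{i,n} u_i^n` of functions on the cube. -/
def momentFeature (d N : ℕ) : (ℝ × (Fin d ⊕ Fin d → Fin N → ℝ)) →ₗ[ℝ] Cube d → ℝ where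
  toFun v u := v.1 + ∑ i, ∑ n : Fin N, v.2 i n * coord i u ^ ((n : ℕ) + 1)
  map_add' v v' := by
    ext u
    simp only [Prod.fst_add, Prod.snd_add, Pi.add_apply, add_mul, Finset.sum_add_distrib]
    ring
  map_smul' a v := by
    ext u
    simp only [Prod.smul_fst, Prod.smul_snd, Pi.smul_apply, smul_eq_mul, RingHom.id_apply,
      mul_add, Finset.mul_sum, mul_assoc]

theorem momentFeature_apply {d N : ℕ} (v : ℝ × (Fin d ⊕ Fin d → Fin N → ℝ)) (u : Cube d) :
    momentFeature d N v u = v.1 + ∑ i, ∑ n : Fin N, v.2 i n * coord i u ^ ((n : ℕ) + 1) := rfl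

/-- The mean of `momentFeature` under uniform marginals. -/
noncomputable def featureMean {d N : ℕ} (v : ℝ × (Fin d ⊕ Fin d → Fin N → ℝ)) : ℝ :=
  v.1 + ∑ i, ∑ n : Fin N, v.2 i n * uniformMoment ((n : ℕ) + 1)

theorem measurable_coord {d : ℕ} (i : Fin d ⊕ Fin d) : Measurable (coord (d := d) i) := by
  rcases i with i | i
  · exact measurable_subtype_coe.comp ((measurable_pi_apply i).comp measurable_fst)
  · exact measurable_subtype_coe.comp ((measurable_pi_apply i).comp measurable_snd)

theorem coord_nonneg {d : ℕ} (i : Fin d ⊕ Fin d) (u : Cube d) : 0 ≤ coord i u := by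
  rcases i with i | i
  · exact (u.1 i).2.1
  · exact (u.2 i).2.1

theorem coord_le_one {d : ℕ} (i : Fin d ⊕ Fin d) (u : Cube d) : coord i u ≤ 1 := by
  rcases i with i | i
  · exact (u.1 i).2.2
  · exact (u.2 i).2.2

theorem isBoundedFamily_momentFeature (d N : ℕ) :
    IsBoundedFamily (momentFeature d N) (1 + ∑ _i : Fin d ⊕ Fin d, ∑ _n : Fin N, (1 : ℝ)) where
  measurable v := by
    have := measurable_coord (d := d)
    simp only [funext (momentFeature_apply v)]
    fun_prop
  abs_apply_le v u := by
    rw [momentFeature_apply, add_mul, one_mul]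
    refine (abs_add_le _ _).trans (add_le_add (norm_fst_le v) ?_)
    simp only [Finset.sum_mul, one_mul]
    refine (Finset.abs_sum_le_sum_abs _ _).trans (Finset.sum_le_sum fun i _ => ?_)
    refine (Finset.abs_sum_le_sum_abs _ _).trans (Finset.sum_le_sum fun n _ => ?_)
    rw [abs_mul, abs_of_nonneg (pow_nonneg (coord_nonneg i u) _)]
    refine (mul_le_of_le_one_right (abs_nonneg _)
      (pow_le_one₀ (coord_nonneg i u) (coord_le_one i u))).trans ?_
    exact (norm_le_pi_norm (v.2 i) n).trans ((norm_le_pi_norm v.2 i).trans (norm_snd_le v))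

theorem integrable_coord_pow {d : ℕ} (Q : Measure (Cube d)) [IsFiniteMeasure Q]
    (i : Fin d ⊕ Fin d) (n : ℕ) : Integrable (fun u => coord i u ^ n) Q :=
  .of_bound ((measurable_coord i).pow_const n).aestronglyMeasurable 1 (ae_of_all _ fun u => by
    rw [Real.norm_eq_abs, abs_of_nonneg (pow_nonneg (coord_nonneg i u) _)]
    exact pow_le_one₀ (coord_nonneg i u) (coord_le_one i u))

theorem MomentConstraints.integral_momentFeature {d N : ℕ} {Q : Measure (Cube d)}
    [IsProbabilityMeasure Q] (h : MomentConstraints N Q) (v : ℝ × (Fin d ⊕ Fin d → Fin N → ℝ)) :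
    ∫ u, momentFeature d N v u ∂ Q = featureMean v := by
  have hi : ∀ i, ∀ n : Fin N, Integrable (fun u => v.2 i n * coord i u ^ ((n : ℕ) + 1)) Q :=
    fun i n => (integrable_coord_pow Q i _).const_mul _
  simp only [momentFeature_apply]
  rw [integral_add (integrable_const _)
    (integrable_finsetSum _ fun i _ => integrable_finsetSum _ fun n _ => hi i n),
    integral_finsetSum _ fun i _ => integrable_finsetSum _ fun n _ => hi i n]
  simp only [integral_finsetSum _ fun n _ => hi _ n, integral_const_mul, h _ _, integral_const,
    probReal_univ, smul_eq_mul, one_mul, featureMean]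

theorem momentConstraints_of_integral_momentFeature {d N : ℕ} {Q : Measure (Cube d)}
    (h : ∀ v, ∫ u, momentFeature d N v u ∂ Q = featureMean v) : MomentConstraints N Q := by
  intro i n
  -- This coefficient vector selects the single monomial `u_i^(n+1)`.
  have := h (0, Pi.single i (Pi.single n 1))
  simpa [momentFeature_apply, featureMean, Pi.single_apply, Finset.sum_ite_eq', ite_apply,
    apply_ite] using this

theorem expDensity_eq_exp {d N : ℕ} (δ : Cube d → ℝ≥0) (l : Multipliers d N) (u : Cube d) :
    expDensity δ l u = Real.exp (l.theta * δ u + momentFeature d N (l.mu, l.nu) u) := by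
  rw [expDensity, ← Real.exp_sum, ← Real.exp_add, momentFeature_apply]
  congr 1
  ring

/-! ### The primal problem and the dual program. -/

section Dual

variable {d N : ℕ} {δ : Cube d → ℝ≥0} {D : ℝ≥0} {R : Measure (Cube d)} {l : Multipliers d N}

/-- The exponent of `expDensity`. -/
noncomputable def exponent (δ : Cube d → ℝ≥0) (l : Multipliers d N) (u : Cube d) : ℝ :=
  l.theta * δ u + momentFeature d N (l.mu, l.nu) u

theorem measurable_exponent (hδ : Measurable δ) (l : Multipliers d N) :
    Measurable (exponent δ l) := by
  have := (isBoundedFamily_momentFeature d N).measurable (l.mu, l.nu)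
  unfold exponent
  fun_prop

theorem dualObjective_of_integrable
    (h : Integrable (fun u => Real.exp (exponent δ l u)) R) :
    dualObjective δ D R l = ((∫ u, Real.exp (exponent δ l u) ∂ R
      - (l.theta * D + featureMean (l.mu, l.nu)) - 1 : ℝ) : EReal) := by
  have hm : expMass δ R l = ENNReal.ofReal (∫ u, Real.exp (exponent δ l u) ∂ R) := by
    rw [ofReal_integral_eq_lintegral_ofReal h (ae_of_all _ fun u => (Real.exp_pos _).le)]
    exact lintegral_congr fun u => by rw [expDensity_eq_exp, exponent]
  rw [dualObjective, hm, EReal.coe_ennreal_ofReal,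
    max_eq_left (integral_nonneg fun u => (Real.exp_pos _).le), ← EReal.coe_one, ← EReal.coe_sub,
    ← EReal.coe_add, featureMean]
  congr 1
  ring

theorem dualObjective_of_not_integrable (hδ : Measurable δ)
    (h : ¬ Integrable (fun u => Real.exp (exponent δ l u)) R) :
    dualObjective δ D R l = ⊤ := by
  have hm : expMass δ R l = ∞ := by
    by_contra hne
    refine h ⟨((measurable_exponent hδ l).exp).aestronglyMeasurable, ?_⟩
    rw [hasFiniteIntegral_iff_ofReal (ae_of_all _ fun u => (Real.exp_pos _).le)]
    refine lt_of_eq_of_lt (lintegral_congr fun u => ?_) (lt_top_iff_ne_top.2 hne)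
    rw [expDensity_eq_exp, exponent]
  rw [dualObjective, hm, EReal.coe_ennreal_top, ← EReal.coe_one, EReal.top_sub_coe,
    EReal.coe_add_top]

theorem Feasible.integrable_distortion (hδ : Measurable δ) {Q : Measure (Cube d)}
    (h : Feasible N δ D Q) : Integrable (fun u => (δ u : ℝ)) Q := by
  refine ⟨(measurable_coe_nnreal_real.comp hδ).aestronglyMeasurable, ?_⟩
  rw [hasFiniteIntegral_iff_ofReal (ae_of_all _ fun u => (δ u).coe_nonneg)]
  simp only [ENNReal.ofReal_coe_nnreal]
  exact h.2.1.trans_lt ENNReal.coe_lt_top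

theorem Feasible.integral_distortion (hδ : Measurable δ) {Q : Measure (Cube d)}
    (h : Feasible N δ D Q) : ∫ u, (δ u : ℝ) ∂ Q = D := by
  have h1 := ofReal_integral_eq_lintegral_ofReal (h.integrable_distortion hδ)
    (ae_of_all _ fun u => (δ u).coe_nonneg)
  simp only [ENNReal.ofReal_coe_nnreal] at h1
  rw [← NNReal.coe_inj.2 (ENNReal.toNNReal_coe D), ← h.2.1, expDistortion, ← h1]
  exact (ENNReal.toReal_ofReal (integral_nonneg fun u => (δ u).coe_nonneg)).symm

theorem Feasible.integrable_exponent (hδ : Measurable δ) {Q : Measure (Cube d)}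
    (h : Feasible N δ D Q) (l : Multipliers d N) : Integrable (exponent δ l) Q := by
  have := h.1
  exact ((h.integrable_distortion hδ).const_mul _).add
    ((isBoundedFamily_momentFeature d N).integrable Q _)

/-- The exponent is a linear combination of constrained functions, so its mean does not depend on
the feasible measure. -/
theorem Feasible.integral_exponent (hδ : Measurable δ) {Q : Measure (Cube d)}
    (h : Feasible N δ D Q) (l : Multipliers d N) :
    ∫ u, exponent δ l u ∂ Q = l.theta * D + featureMean (l.mu, l.nu) := by
  have := h.1
  simp only [exponent]
  rw [integral_add ((h.integrable_distortion hδ).const_mul _)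
    ((isBoundedFamily_momentFeature d N).integrable Q _), integral_const_mul,
    h.integral_distortion hδ, h.2.2.integral_momentFeature]

/-- A feasible measure of exponential form solves the primal problem, its multipliers solve the
dual program, and the density of every other dual solution coincides with its own. -/
theorem isMinimizer_and_isDualSolution_of_feasible [IsProbabilityMeasure R] (hδ : Measurable δ)
    (h : Feasible N δ D (R.withDensity fun u => ENNReal.ofReal (Real.exp (exponent δ l u)))) :
    IsMinimizer N δ D R (R.withDensity fun u => ENNReal.ofReal (Real.exp (exponent δ l u))) ∧
      IsDualSolution δ D R l ∧
      ∀ l' : Multipliers d N, IsDualSolution δ D R l' → HasExpDensity δ R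
        (R.withDensity fun u => ENNReal.ofReal (Real.exp (exponent δ l u))) l' := by
  have hl := measurable_exponent hδ l
  set Q := R.withDensity fun u => ENNReal.ofReal (Real.exp (exponent δ l u)) with hQ
  have hQp : IsProbabilityMeasure Q := h.1
  have hexp : Integrable (fun u => Real.exp (exponent δ l u)) R := by
    have := (integrable_withDensity_exp hl (R := R) (f := fun _ => (1 : ℝ))).1 (integrable_const 1)
    simpa using this
  have hsub : ∀ l' : Multipliers d N,
      Integrable (fun u => exponent δ l' u - exponent δ l u) Q := fun l' =>
    (h.integrable_exponent hδ l').sub (h.integrable_exponent hδ l)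
  -- The linear parts of the two dual objectives differ by the `Q`-mean of the difference of
  -- exponents, the slope in the tangent inequality.
  have hmean : ∀ l' : Multipliers d N, ∫ u, (exponent δ l' u - exponent δ l u) ∂ Q
      = (l'.theta * D + featureMean (l'.mu, l'.nu)) - (l.theta * D + featureMean (l.mu, l.nu)) :=
    fun l' => by
      rw [integral_sub (h.integrable_exponent hδ l') (h.integrable_exponent hδ l),
        h.integral_exponent hδ, h.integral_exponent hδ]
  refine ⟨⟨h, fun Q' hQ' => ?_⟩, fun l' => ?_, fun l' hl' => ?_⟩
  · have := hQ'.1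
    exact klDiv_withDensity_exp_le hl (h.integrable_exponent hδ l) (hQ'.integrable_exponent hδ l)
      (by rw [← hQ, hQ'.integral_exponent hδ, h.integral_exponent hδ])
  · by_cases hexp' : Integrable (fun u => Real.exp (exponent δ l' u)) R
    · rw [dualObjective_of_integrable hexp, dualObjective_of_integrable hexp', EReal.coe_le_coe_iff]
      have := (integral_sub_le_integral_exp_sub hl hexp hexp' (hsub l')).1
      rw [← hQ, hmean] at this
      linarith
    · rw [dualObjective_of_not_integrable hδ hexp']
      exact le_top
  · have hle := hl' l
    have hexp' : Integrable (fun u => Real.exp (exponent δ l' u)) R := by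
      by_contra hn
      rw [dualObjective_of_not_integrable hδ hn, dualObjective_of_integrable hexp] at hle
      exact EReal.coe_ne_top _ (top_le_iff.1 hle)
    rw [dualObjective_of_integrable hexp, dualObjective_of_integrable hexp',
      EReal.coe_le_coe_iff] at hle
    have heq := (integral_sub_le_integral_exp_sub hl hexp hexp' (hsub l')).2
      (by rw [← hQ, hmean]; linarith)
    refine ⟨withDensity_absolutelyContinuous R _, ?_⟩
    filter_upwards [Measure.rnDeriv_withDensity R
      (f := fun u => ENNReal.ofReal (Real.exp (exponent δ l u))) (by fun_prop), heq] with u hu hu'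
    rw [hQ, hu, expDensity_eq_exp, ← hu', exponent]

/-- Existence of a feasible measure of exponential form. -/
theorem exists_feasible_withDensity_exp [IsProbabilityMeasure R] (hR : MomentConstraints N R)
    (hδ : Measurable δ) (hmin : distortionMin N δ R ≤ D) (hmax : D ≤ distortionMax δ R)
    (hne : D = distortionMin N δ R → distortionMin N δ R = distortionMax δ R) :
    ∃ l : Multipliers d N,
      Feasible N δ D (R.withDensity fun u => ENNReal.ofReal (Real.exp (exponent δ l u))) := by
  rcases hmax.eq_or_lt with heq | hlt
  · refine ⟨⟨0, 0, 0⟩, ?_⟩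
    have h0 : exponent δ (⟨0, 0, 0⟩ : Multipliers d N) = 0 := by
      ext u
      simp [exponent, momentFeature_apply]
    simp only [h0, Pi.zero_apply, Real.exp_zero, ENNReal.ofReal_one, withDensity_const, one_smul]
    exact ⟨inferInstance, heq.symm, hR⟩
  -- `D < D_max` excludes `D = D_min`, so the infimum provides a measure of finite divergence with
  -- distortion strictly below `D`.
  have hDmin : distortionMin N δ R < D := lt_of_le_of_ne hmin fun h =>
    hlt.ne (h.symm.trans (hne h.symm))
  obtain ⟨e, ⟨Q, hQ, hQm, hkl, rfl⟩, he⟩ := sInf_lt_iff.1 hDmin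
  have hD₀ := ENNReal.coe_toNNReal (he.trans ENNReal.coe_lt_top).ne
  set D₀ := (expDistortion δ Q).toNNReal
  have hQf : Feasible N δ D₀ Q := ⟨hQ, hD₀.symm, hQm⟩
  have hF := isBoundedFamily_momentFeature d N
  obtain ⟨θ, hθ, v, hv⟩ := hF.exists_isMin_expObjective (by positivity) (R := R) (Q := Q) hδ
    (D := D) hkl.ne (fun v => by rw [hQm.integral_momentFeature, hR.integral_momentFeature])
    (hQf.integrable_distortion hδ) (by
      rw [hQf.integral_distortion hδ]
      rw [← hD₀] at he
      exact_mod_cast he)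
  have hθ' : θ < 0 := hF.neg_of_isMin_expObjective hδ hlt hθ hv
  have hmean := fun x => (hF.integral_eq_of_isMin_expObjective hδ hθ hv x).trans
    (hR.integral_momentFeature x)
  have hdist := hF.integral_distortion_eq_of_isMin_expObjective hδ hθ' hv
  have hfin : Integrable (fun u => Real.exp (θ * δ u + momentFeature d N v u)) R :=
    hF.integrable_exp R hδ hθ v
  refine ⟨⟨v.1, θ, v.2⟩, ?_⟩
  simp only [exponent]
  set Q' := R.withDensity fun u => ENNReal.ofReal (Real.exp (θ * δ u + momentFeature d N v u))
  have hQ'fin : IsFiniteMeasure Q' := isFiniteMeasure_withDensity_ofReal hfin.2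
  have hprob : IsProbabilityMeasure Q' := by
    -- The constant feature, i.e. stationarity in `μ`, gives total mass one.
    have h1 := hmean (1, 0)
    simp only [momentFeature_apply, featureMean, Pi.zero_apply, zero_mul, Finset.sum_const_zero,
      add_zero, integral_const, smul_eq_mul, mul_one] at h1
    exact ⟨by rwa [measureReal_def, ENNReal.toReal_eq_one_iff] at h1⟩
  refine ⟨hprob, ?_, momentConstraints_of_integral_momentFeature hmean⟩
  -- Half of the decay absorbs `δ`: `δ exp (θ δ)` is at most a constant times `exp (θ δ / 2)`.
  -- Integrability turns the Bochner mean into the `[0,∞]`-valued distortion.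
  have hint : Integrable (fun u => (δ u : ℝ)) Q' := by
    have := hF.measurable v
    rw [integrable_withDensity_exp (g := fun u => θ * δ u + momentFeature d N v u) (by fun_prop)]
    refine ((hF.integrable_exp R hδ (by linarith : θ / 2 ≤ 0) v).const_mul (-(2 / θ))).mono
      (by fun_prop) (ae_of_all _ fun u => ?_)
    have h1 : (δ u : ℝ) ≤ -(2 / θ) * Real.exp (-(θ / 2 * δ u)) := by
      have h2 := Real.add_one_le_exp (-(θ / 2 * δ u))
      have h3 : 0 < -(2 / θ) := by
        rw [neg_pos]
        exact div_neg_of_pos_of_neg two_pos hθ'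
      have h4 := mul_le_mul_of_nonneg_left h2 h3.le
      have h5 : -(2 / θ) * (-(θ / 2 * δ u) + 1) = δ u + -(2 / θ) := by
        have := hθ'.ne
        field_simp
        ring
      linarith
    rw [Real.norm_of_nonneg (mul_nonneg (Real.exp_pos _).le (δ u).coe_nonneg)]
    refine (mul_le_mul_of_nonneg_left h1 (Real.exp_pos _).le).trans (le_trans (le_of_eq ?_)
      (le_abs_self _))
    rw [mul_left_comm, ← Real.exp_add]
    congr 2
    ring
  rw [← ENNReal.ofReal_coe_nnreal, ← hdist, ofReal_integral_eq_lintegral_ofReal hint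
    (ae_of_all _ fun u => (δ u).coe_nonneg)]
  simp only [expDistortion, ENNReal.ofReal_coe_nnreal]

end Dual

/-! ### Measurability of the distortion, and the moments of the product of the copulas. -/

theorem monotoneOn_quantile (m : Measure ℝ) : MonotoneOn (quantile m) (Set.Ioo 0 1) := by
  intro a ha b hb hab
  -- Strictly between `0` and `1` the limits of the distribution function make these sets nonempty
  -- and bounded above, so `sSup` is a true supremum.
  refine csSup_le_csSup ?_ ?_ fun x hx => le_trans hx hab
  · obtain ⟨y, hy⟩ := ((tendsto_cdf_atTop m).eventually (lt_mem_nhds hb.2)).exists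
    refine ⟨y, fun x hx => ?_⟩
    by_contra! h
    exact absurd (hy.trans_le (monotone_cdf m h.le)) (not_lt.2 hx)
  · obtain ⟨y, hy⟩ := ((tendsto_cdf_atBot m).eventually (gt_mem_nhds ha.1)).exists
    exact ⟨y, hy.le⟩

/-- At the end points `sSup` may take its default value and break monotonicity; two points do not
affect measurability. -/
theorem measurable_quantile (m : Measure ℝ) : Measurable fun u : I => quantile m u := by
  refine measurable_of_measurable_on_compl_finite {0, 1} (Set.toFinite _) (Monotone.measurable ?_)
  have hmem : ∀ a : (({0, 1} : Set I)ᶜ : Set I), ((a : I) : ℝ) ∈ Set.Ioo (0 : ℝ) 1 := fun a => by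
    have h := a.2
    simp only [Set.mem_compl_iff, Set.mem_insert_iff, Set.mem_singleton_iff, not_or] at h
    exact ⟨unitInterval.pos_iff_ne_zero.2 h.1, unitInterval.lt_one_iff_ne_one.2 h.2⟩
  exact fun a b hab => monotoneOn_quantile m (hmem a) (hmem b) hab

theorem measurable_vecQuantile {d : ℕ} (m : Measure (Fin d → ℝ)) : Measurable (vecQuantile m) :=
  measurable_pi_lambda _ fun i => (measurable_quantile _).comp (measurable_pi_apply i)

theorem measurable_copulaDistortion {d : ℕ} (mX mY : Measure (Fin d → ℝ))
    {Δ : (Fin d → ℝ) → (Fin d → ℝ) → ℝ≥0} (hΔ : Measurable (Function.uncurry Δ)) :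
    Measurable (copulaDistortion mX mY Δ) :=
  hΔ.comp (((measurable_vecQuantile mX).comp measurable_fst).prodMk
    ((measurable_vecQuantile mY).comp measurable_snd))

theorem IsCopula.integral_pow {d : ℕ} {C : Measure (Fin d → I)} (hC : IsCopula C) (i : Fin d)
    (n : ℕ) : ∫ u, (u i : ℝ) ^ n ∂ C = uniformMoment n := by
  rw [uniformMoment, ← hC.uniform_marginal i, integral_map (measurable_pi_apply i).aemeasurable
    (measurable_subtype_coe.pow_const n).aestronglyMeasurable]

theorem momentConstraints_prod {d : ℕ} (N : ℕ) {CX CY : Measure (Fin d → I)} (hX : IsCopula CX)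
    (hY : IsCopula CY) : MomentConstraints N (CX.prod CY) := by
  have := hX.isProb
  have := hY.isProb
  rintro (i | i) n
  · rw [← hX.integral_pow i]
    exact (integral_fun_fst (μ := CX) (ν := CY) fun x => (x i : ℝ) ^ ((n : ℕ) + 1)).trans (by simp)
  · rw [← hY.integral_pow i]
    exact (integral_fun_snd (μ := CX) (ν := CY) fun x => (x i : ℝ) ^ ((n : ℕ) + 1)).trans (by simp)

theorem theorem5 (d N : ℕ)
    (mX mY : Measure (Fin d → ℝ)) (hmX : IsProbabilityMeasure mX) (hmY : IsProbabilityMeasure mY)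
    (CX CY : Measure (Fin d → I)) (hCX : IsCopulaOf CX mX) (hCY : IsCopulaOf CY mY)
    (Δ : (Fin d → ℝ) → (Fin d → ℝ) → ℝ≥0) (hΔ : Measurable (Function.uncurry Δ))
    (δ : Cube d → ℝ≥0) (hδ : δ = copulaDistortion mX mY Δ)
    (R : Measure (Cube d)) (hR : R = CX.prod CY)
    (D : ℝ≥0)
    (hDmin : distortionMin N δ R ≤ D) (hDmax : D ≤ distortionMax δ R)
    (hDne : D = distortionMin N δ R → distortionMin N δ R = distortionMax δ R)
    (hP : ∃ P : Measure (Cube d), IsProbabilityMeasure P ∧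
      InformationTheory.klDiv P R < ∞ ∧ expDistortion δ P = D) :
    ∃ Q : Measure (Cube d), IsMinimizer N δ D R Q ∧
      (∃ l : Multipliers d N, IsDualSolution δ D R l ∧ HasExpDensity δ R Q l) ∧
      (∀ l : Multipliers d N, IsDualSolution δ D R l → HasExpDensity δ R Q l) := by
  have hCXp := hCX.isCopula.isProb
  have hCYp := hCY.isCopula.isProb
  have hδm : Measurable δ := hδ ▸ measurable_copulaDistortion mX mY hΔ
  have hRm : MomentConstraints N R := hR ▸ momentConstraints_prod N hCX.isCopula hCY.isCopula
  have hRp : IsProbabilityMeasure R := by rw [hR]; infer_instance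
  obtain ⟨l, hl⟩ := exists_feasible_withDensity_exp hRm hδm hDmin hDmax hDne
  obtain ⟨hQ, hdual, hall⟩ := isMinimizer_and_isDualSolution_of_feasible hδm hl
  exact ⟨_, hQ, ⟨l, hdual, hall l hdual⟩, hall⟩
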